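/- Conventions. A \emph{graph} is a finite non-empty set $G$ with a reflexive symmetric edge relation $\sqcap$. A relation ${\sqsupset}\subseteq H\times G$ between graphs is \emph{edge-preserving} if $h\sqsupset g\sqcap g'\sqsubset h'$ implies $h\sqcap h'$; \emph{co-bijective} if every $g\in G$ satisfies $h\sqsupset g$ for some $h\in H$, and for every $h\in H$ there is $g\in G$ such that $h$ is the only element of $H$ with $h\sqsupset g$; \emph{edge-witnessing} if $h\sqcap h'$ implies that there is $g\in G$ with $h\sqsupset g$ and $h'\sqsupset g$; \emph{anti-injective} if for every $h\in H$ there are at least two $g\in G$ with $h\sqsupset g$; and \emph{star-refining} if for every $g\in G$ there is $h\in H$ with $h\sqsupset g'$ for all $g'\sqcap g$. A \emph{sequence} $(G_n,\sqsupset^m_n)$ of graphs consists of graphs $G_n$ ($n\in\omega$) and edge-preserving relations ${\sqsupset^m_n}\subseteq G_m\times G_n$ ($m\le n$) such that $\sqsupset^n_n$ is the identity and ${\sqsupset^l_m}\circ{\sqsupset^m_n}={\sqsupset^l_n}$ for $l\le m\le n$. It is called co-bijective, edge-witnessing, anti-injective or star-refining if $\sqsupset^m_n$ is so for all $m<n$.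 Its \emph{induced poset} is the disjoint union of the sets $G_n$, where, for $p\in G_n$ and $q\in G_m$, $p\le q$ if and only if $m\le n$ and $q\sqsupset^m_n p$. In a poset $\mathbb P$, a \emph{band} is a finite subset $B$ such that every element of $\mathbb P$ is comparable to some element of $B$; a \emph{cap} is a subset $C$ such that for some band $B$ every $b\in B$ lies below some $c\in C$; a \emph{selector} is a subset of $\mathbb P$ that meets every cap. The \emph{spectrum} of $\mathbb P$ is the set of all inclusion-minimal selectors, with the topology generated by the sets $\{S : p\in S\}$, $p\in\mathbb P$. The spectrum of a co-bijective sequence is the spectrum of its induced poset. \textbf{Proposition.} Let $X$ be a non-empty second-countable compact $\mathsf T_1$ space. Then $X$ is homeomorphic to the spectrum of an edge-witnessing co-bijective sequence of graphs. Moreover, this sequence can be chosen so that it is additionally anti-injective if $X$ is perfect (has no isolated points), and additionally star-refining if $X$ is Hausdorff (and both, if $X$ is both). -/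

import Mathlib

/-! ### Relations

A relation `r : A → B → Prop` stands for `⊐ ⊆ A × B`, viewed as a relation from `B` to `A`:
`r a b` reads `a ⊐ b`. -/

/-- Every `a ∈ A` is related to at least one `b ∈ B`. -/
def RelSurjective {A B : Type*} (r : A → B → Prop) : Prop :=
  ∀ a, ∃ b, r a b

/-- For every `b ∈ B` there is some `a ∈ A` which is related to `b` and to nothing else. -/
def RelInjective {A B : Type*} (r : A → B → Prop) : Prop :=
  ∀ b, ∃ a, ∀ b', r a b' ↔ b' = b

/-- Bijective relations: surjective and injective. -/
def RelBijective {A B : Type*} (r : A → B → Prop) : Prop :=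
  RelSurjective r ∧ RelInjective r

/-- A relation is co-bijective if the opposite relation is bijective. -/
def RelCoBijective {A B : Type*} (r : A → B → Prop) : Prop :=
  RelBijective (flip r)

/-! ### Graphs and morphisms -/

/-- A finite nonempty graph: a finite nonempty vertex set with a reflexive symmetric
edge relation. -/
structure FinGraph where
  /-- The set of vertices. -/
  V : Type
  finite : Finite V
  nonempty : Nonempty V
  /-- The edge relation. -/
  Edge : V → V → Prop
  edge_refl : ∀ g, Edge g g
  edge_symm : ∀ g h, Edge g h → Edge h g

/-- `h ⊐ g ⊓ g' ⊏ h'` implies `h ⊓ h'`. These are the morphisms `G → H` of the graph category. -/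
def EdgePreserving {H G : FinGraph} (r : H.V → G.V → Prop) : Prop :=
  ∀ h h' g g', r h g → G.Edge g g' → r h' g' → H.Edge h h'

/-- `h ⊓ h'` implies `h ⊐ g ⊏ h'` for some `g`. -/
def EdgeWitnessing {H G : FinGraph} (r : H.V → G.V → Prop) : Prop :=
  ∀ h h', H.Edge h h' → ∃ g, r h g ∧ r h' g

/-- Every vertex `h` is related to at least two vertices `g`. -/
def AntiInjective {H G : FinGraph} (r : H.V → G.V → Prop) : Prop :=
  ∀ h, {g | r h g}.Nontrivial

/-- For every `g` there is `h` which is related to every `g'` with `g ⊓ g'`. -/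
def StarRefining {H G : FinGraph} (r : H.V → G.V → Prop) : Prop :=
  ∀ g, ∃ h, ∀ g', G.Edge g g' → r h g'

/-! ### Sequences of graphs -/

/-- A sequence `(Gₙ, ⊐ᵐₙ)` in the category of finite nonempty graphs and edge-preserving
relations; `rel m n hmn p q` reads `p ⊐ᵐₙ q`, where `p ∈ Gₘ` and `q ∈ Gₙ`. -/
structure GraphSequence where
  /-- The graphs. -/
  G : ℕ → FinGraph
  /-- The bonding relations. -/
  rel : ∀ m n : ℕ, m ≤ n → (G m).V → (G n).V → Prop
  edgePreserving : ∀ (m n : ℕ) (hmn : m ≤ n), EdgePreserving (rel m n hmn)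
  rel_self : ∀ (n : ℕ) (p q : (G n).V), rel n n le_rfl p q ↔ p = q
  rel_comp : ∀ (l m n : ℕ) (hlm : l ≤ m) (hmn : m ≤ n) (p : (G l).V) (q : (G n).V),
    rel l n (hlm.trans hmn) p q ↔ ∃ t : (G m).V, rel l m hlm p t ∧ rel m n hmn t q

namespace GraphSequence

/-- All bonding relations are co-bijective. -/
def IsCoBijective (s : GraphSequence) : Prop :=
  ∀ (m n : ℕ) (hmn : m ≤ n), RelCoBijective (s.rel m n hmn)

/-- All bonding relations with `m < n` are edge-witnessing. -/
def IsEdgeWitnessing (s : GraphSequence) : Prop :=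
  ∀ (m n : ℕ) (hmn : m < n), EdgeWitnessing (s.rel m n hmn.le)

/-- All bonding relations with `m < n` are anti-injective. -/
def IsAntiInjective (s : GraphSequence) : Prop :=
  ∀ (m n : ℕ) (hmn : m < n), AntiInjective (s.rel m n hmn.le)

/-- All bonding relations with `m < n` are star-refining. -/
def IsStarRefining (s : GraphSequence) : Prop :=
  ∀ (m n : ℕ) (hmn : m < n), StarRefining (s.rel m n hmn.le)

/-- The underlying set of the induced poset: the disjoint union of the vertex sets. -/
def InducedPoset (s : GraphSequence) : Type :=
  Σ n : ℕ, (s.G n).V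

/-- The order of the induced poset: for `p ∈ Gₙ` and `q ∈ Gₘ`,
`p ≤ q` iff `m ≤ n` and `q ⊐ᵐₙ p`. -/
instance (s : GraphSequence) : PartialOrder s.InducedPoset where
  le p q := ∃ hmn : q.1 ≤ p.1, s.rel q.1 p.1 hmn q.2 p.2
  le_refl p := ⟨le_rfl, (s.rel_self p.1 p.2 p.2).2 rfl⟩
  le_trans := by
    rintro p q t ⟨h₁, r₁⟩ ⟨h₂, r₂⟩
    exact ⟨h₂.trans h₁, (s.rel_comp _ _ _ h₂ h₁ _ _).2 ⟨q.2, r₂, r₁⟩⟩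
  le_antisymm := by
    rintro ⟨n, p⟩ ⟨m, q⟩ ⟨h₁, r₁⟩ ⟨h₂, _⟩
    obtain rfl : n = m := le_antisymm h₂ h₁
    obtain rfl := (s.rel_self _ _ _).1 r₁
    rfl

end GraphSequence

/-! ### The spectrum of a poset -/

/-- A band: a finite set such that every element of the poset is comparable to one of its
members. -/
def IsBand {P : Type*} [PartialOrder P] (B : Set P) : Prop :=
  B.Finite ∧ ∀ p : P, ∃ b ∈ B, b ≤ p ∨ p ≤ b

/-- A cap: a set which is refined by some band. -/
def IsCap {P : Type*} [PartialOrder P] (C : Set P) : Prop :=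
  ∃ B : Set P, IsBand B ∧ ∀ b ∈ B, ∃ c ∈ C, b ≤ c

/-- A selector: a set which meets every cap. -/
def IsSelector {P : Type*} [PartialOrder P] (S : Set P) : Prop :=
  ∀ C : Set P, IsCap C → (S ∩ C).Nonempty

/-- The spectrum of a poset: the set of its inclusion-minimal selectors. -/
def PosetSpectrum (P : Type*) [PartialOrder P] : Type _ :=
  {S : Set P // Minimal IsSelector S}

/-- The topology of the spectrum is generated by the sets of all minimal selectors that
contain `p`, for `p` in the poset. -/
instance (P : Type*) [PartialOrder P] : TopologicalSpace (PosetSpectrum P) :=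
  TopologicalSpace.generateFrom
    (Set.range fun p : P => {S : PosetSpectrum P | p ∈ S.1})

open Set Topology

/-! The graphs are nerves of finite open covers, bonded by inclusion. The covers are chosen so that
a member containing the distinguished point of a member of the next cover contains that whole
member, and so that every point has a neighbourhood in the next cover lying inside all current
members around it (`exists_consolidation`). The first property lets inclusions factor through
intermediate levels, the second yields edge-witnessing; private points give co-bijectivity.

Cofinality among open covers then identifies points with minimal selectors: caps cover `X`, so the
names of a point form a selector, and compactness puts such a set inside every selector. -/

/-- A finite open cover of `X`, each member of which has a distinguished point lying in no other
member. -/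
structure PointedCover (X : Type*) [TopologicalSpace X] where
  /-- The number of members. -/
  size : ℕ
  /-- The members of the cover. -/
  set : Fin size → Set X
  /-- The distinguished points. -/
  pt : Fin size → X
  isOpen : ∀ i, IsOpen (set i)
  exists_mem : ∀ x, ∃ i, x ∈ set i
  pt_mem_iff : ∀ i j, pt i ∈ set j ↔ i = j

/-- A finite family covering `T` has a subfamily still covering `T` in which every member has a
point of `T` that lies in no other member. -/
theorem exists_irredundant_subfamily {X : Type*} [Nonempty X] {F : Set (Set X)} (hF : F.Finite) {T : Set X}
    (hT : T ⊆ ⋃₀ F) :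
    ∃ (G : Set (Set X)) (pt : Set X → X), G ⊆ F ∧ T ⊆ ⋃₀ G ∧
      ∀ q ∈ G, pt q ∈ T ∧ pt q ∈ q ∧ ∀ q' ∈ G, pt q ∈ q' → q = q' := by
  have hfin : {G : Set (Set X) | G ⊆ F ∧ T ⊆ ⋃₀ G}.Finite :=
    hF.finite_subsets.subset fun G hG => hG.1
  obtain ⟨G, hG⟩ := hfin.exists_minimal ⟨F, subset_rfl, hT⟩
  have key : ∀ q ∈ G, ∃ x ∈ T, x ∈ q ∧ ∀ q' ∈ G, x ∈ q' → q = q' := by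
    intro q hq
    by_contra! hcon
    have hmem : G \ {q} ∈ {G : Set (Set X) | G ⊆ F ∧ T ⊆ ⋃₀ G} := by
      refine ⟨sdiff_subset.trans hG.prop.1, fun x hx => ?_⟩
      obtain ⟨q₁, hq₁, hxq₁⟩ := hG.prop.2 hx
      by_cases h : q₁ = q
      · subst h
        obtain ⟨q', hq', hxq', hne⟩ := hcon x hx hxq₁
        exact ⟨q', ⟨hq', fun h => hne h.symm⟩, hxq'⟩
      · exact ⟨q₁, ⟨hq₁, h⟩, hxq₁⟩
    exact (hG.le_of_le hmem sdiff_subset hq).2 rfl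
  have : ∀ q, ∃ x, q ∈ G → x ∈ T ∧ x ∈ q ∧ ∀ q' ∈ G, x ∈ q' → q = q' := by
    intro q
    by_cases hq : q ∈ G
    · obtain ⟨x, hx⟩ := key q hq
      exact ⟨x, fun _ => hx⟩
    · exact ⟨Classical.arbitrary X, fun h => absurd h hq⟩
  choose pt hpt using this
  exact ⟨G, pt, hG.prop.1, hG.prop.2, hpt⟩

/-- Pointed covers can be transferred along a finite index type. -/
theorem PointedCover.exists_of_finite {X ι : Type*} [TopologicalSpace X] [Finite ι]
    (U : ι → Set X) (pt : ι → X) (hU : ∀ i, IsOpen (U i)) (hcov : ∀ x, ∃ i, x ∈ U i)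
    (hpt : ∀ i j, pt i ∈ U j ↔ i = j) :
    ∃ (D : PointedCover X) (e : Fin D.size ≃ ι), (∀ j, D.set j = U (e j)) ∧
      ∀ j, D.pt j = pt (e j) := by
  let e := (Finite.equivFin ι).symm
  refine ⟨⟨Nat.card ι, fun j => U (e j), fun j => pt (e j), fun j => hU _, fun x => ?_,
    fun i j => ?_⟩, e, fun _ => rfl, fun _ => rfl⟩
  · obtain ⟨i, hi⟩ := hcov x
    exact ⟨e.symm i, by simpa using hi⟩
  · simp [hpt]

/-! ### Refining a single cover -/

namespace PointedCover

variable {X : Type*} [TopologicalSpace X]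

/-- Every pointed cover of a compact `T₁` space has a refinement, as fine as desired, that
expresses each member of the original cover as a union of members of the new one. -/
theorem exists_consolidation [Nonempty X] [CompactSpace X] [T1Space X] (C : PointedCover X)
    {P : Set X → Prop} (hmono : ∀ q q', q ⊆ q' → P q' → P q)
    (hP : ∀ x, ∃ q, IsOpen q ∧ x ∈ q ∧ P q) :
    ∃ D : PointedCover X, (∀ j, P (D.set j)) ∧
      (∀ x, ∃ j, x ∈ D.set j ∧ ∀ i, x ∈ C.set i → D.set j ⊆ C.set i) ∧
      ∀ j i, D.pt j ∈ C.set i → D.set j ⊆ C.set i := by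
  classical
  choose q hqo hxq hPq using hP
  obtain ⟨t, ht⟩ := CompactSpace.elim_nhds_subcover q fun x => (hqo x).mem_nhds (hxq x)
  let F : Set (Set X) := q '' t
  have hFfin : F.Finite := t.finite_toSet.image q
  have hFopen : ∀ u ∈ F, IsOpen u := by rintro _ ⟨x, -, rfl⟩; exact hqo x
  have hFP : ∀ u ∈ F, P u := by rintro _ ⟨x, -, rfl⟩; exact hPq x
  have hFcov : ⋃₀ F = univ := by
    rw [← top_eq_univ, ← ht, sUnion_image]; rfl
  -- The atoms of `C`. Each is covered irredundantly on its own, so one set of `F` may serve several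
  -- atoms; hence the index type of pairs below.
  let T : Set (Fin C.size) → Set X := fun A => {x | ∀ i, x ∈ C.set i ↔ i ∈ A}
  have hsub := fun A => exists_irredundant_subfamily hFfin (T := T A)
    (by rw [hFcov]; exact subset_univ _)
  choose G pt hGF hGT hpt using hsub
  let ι := {a : Set (Fin C.size) × Set X // a.2 ∈ G a.1}
  have hι : Finite ι := by
    have : {a : Set (Fin C.size) × Set X | a.2 ∈ G a.1}.Finite :=
      ((finite_univ (α := Set (Fin C.size))).prod hFfin).subset
        fun a ha => ⟨mem_univ _, hGF _ ha⟩
    exact this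
  let y : ι → X := fun a => pt a.1.1 a.1.2
  have hyT : ∀ a : ι, ∀ i, y a ∈ C.set i ↔ i ∈ a.1.1 := fun a => (hpt _ _ a.2).1
  have hyinj : Function.Injective y := by
    rintro ⟨⟨A, u⟩, hu⟩ ⟨⟨B, v⟩, hv⟩ hab
    have hAB : A = B := by
      ext i
      rw [← hyT ⟨⟨A, u⟩, hu⟩ i, hab, hyT ⟨⟨B, v⟩, hv⟩ i]
    subst hAB
    have huv : u = v := (hpt A u hu).2.2 v hv (by
      have h : pt A u = pt A v := hab
      rw [h]; exact (hpt A v hv).2.1)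
    subst huv
    rfl
  -- Cutting down to the members of `C` indexed by the atom gives the inclusions; deleting the other
  -- distinguished points, a finite and hence closed set, makes `y a` private. A deleted point is
  -- still covered by its own set.
  let U : ι → Set X := fun a =>
    (a.1.2 ∩ ⋂ i ∈ a.1.1, C.set i) ∩ (range y \ {y a})ᶜ
  have hUC : ∀ a : ι, ∀ i ∈ a.1.1, U a ⊆ C.set i := fun a i hi x hx =>
    mem_iInter₂.1 hx.1.2 i hi
  have hyU : ∀ a, y a ∈ U a := fun a =>
    ⟨⟨(hpt _ _ a.2).2.1, mem_iInter₂.2 fun i hi => (hyT a i).2 hi⟩, fun h => h.2 rfl⟩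
  have hUo : ∀ a, IsOpen (U a) := fun a =>
    ((hFopen _ (hGF _ a.2)).inter ((toFinite _).isOpen_biInter fun i _ => C.isOpen i)).inter
      ((finite_range y).subset sdiff_subset).isClosed.isOpen_compl
  have hUex : ∀ x, ∃ a, x ∈ U a ∧ ∀ i, x ∈ C.set i → U a ⊆ C.set i := by
    intro x
    by_cases hx : x ∈ range y
    · obtain ⟨a, rfl⟩ := hx
      exact ⟨a, hyU a, fun i hi => hUC a i ((hyT a i).1 hi)⟩
    · let A : Set (Fin C.size) := {i | x ∈ C.set i}
      have hxT : x ∈ T A := fun i => Iff.rfl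
      obtain ⟨u, hu, hxu⟩ := hGT A hxT
      exact ⟨⟨⟨A, u⟩, hu⟩, ⟨⟨hxu, mem_iInter₂.2 fun i hi => hi⟩, fun h => hx h.1⟩,
        fun i hi => hUC ⟨⟨A, u⟩, hu⟩ i hi⟩
  obtain ⟨D, e, hDU, hDy⟩ := exists_of_finite U y hUo
    (fun x => (hUex x).imp fun a ha => ha.1) (fun a b => by
      refine ⟨fun h => ?_, fun h => h ▸ hyU a⟩
      by_contra hne
      exact h.2 ⟨mem_range_self a, fun h' => hne (hyinj h')⟩)
  refine ⟨D, fun j => ?_, fun x => ?_, fun j i hji => ?_⟩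
  · rw [hDU]
    exact hmono _ _ (inter_subset_left.trans inter_subset_left) (hFP _ (hGF _ (e j).2))
  · obtain ⟨a, ha⟩ := hUex x
    refine ⟨e.symm a, ?_⟩
    rw [hDU]
    simpa using ha
  · rw [hDU]
    rw [hDy] at hji
    exact hUC _ _ ((hyT _ _).1 hji)

/-- In a compact Hausdorff space, small enough open sets star-refine a given cover. -/
theorem exists_star_small [CompactSpace X] [T2Space X] (C : PointedCover X) :
    ∃ P : Set X → Prop, (∀ q q', q ⊆ q' → P q' → P q) ∧
      (∀ x, ∃ q, IsOpen q ∧ x ∈ q ∧ P q) ∧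
      ∀ q, P q → ∃ i, ∀ q', P q' → (q ∩ q').Nonempty → q' ⊆ C.set i := by
  let _ : UniformSpace X := uniformSpaceOfCompactR1
  obtain ⟨V, hV, hVC⟩ := lebesgue_number_lemma (K := (univ : Set X)) isCompact_univ C.isOpen
    (fun x _ => mem_iUnion.2 (C.exists_mem x))
  obtain ⟨W, hW, hWs, hWV⟩ := comp_comp_symm_mem_uniformity_sets hV
  -- Three `W`-steps lead from the centre of `q` through a common point and the centre of `q'` to
  -- any point of `q'`, so `q'` lies in a Lebesgue `V`-ball.
  refine ⟨fun q => ∃ a, q ⊆ UniformSpace.ball a W, fun q q' h ⟨a, ha⟩ => ⟨a, h.trans ha⟩,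
    fun x => ⟨interior (UniformSpace.ball x W), isOpen_interior,
      mem_interior_iff_mem_nhds.2 (UniformSpace.ball_mem_nhds x hW), x, interior_subset⟩, ?_⟩
  rintro q ⟨a, ha⟩
  obtain ⟨i, hi⟩ := hVC a (mem_univ a)
  refine ⟨i, ?_⟩
  rintro q' ⟨b, hb⟩ ⟨z, hz, hz'⟩ x hx
  refine hi (hWV ?_)
  exact ⟨b, ⟨z, ha hz, UniformSpace.mem_ball_symmetry.1 (hb hz')⟩, hb hx⟩

/-- Small enough open sets separate the distinguished point of a member from some other point of
that member. -/
theorem exists_separating_small [T1Space X] (C : PointedCover X) :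
    ∃ P : Set X → Prop, (∀ q q', q ⊆ q' → P q' → P q) ∧
      (∀ x, ∃ q, IsOpen q ∧ x ∈ q ∧ P q) ∧
      ∀ i, (C.set i).Nontrivial → ∃ y ∈ C.set i, ∀ q, P q → ¬ (C.pt i ∈ q ∧ y ∈ q) := by
  have : ∀ i, ∃ y, (C.set i).Nontrivial → y ∈ C.set i ∧ y ≠ C.pt i := by
    intro i
    by_cases h : (C.set i).Nontrivial
    · obtain ⟨y, hy⟩ := h.exists_ne (C.pt i)
      exact ⟨y, fun _ => hy⟩
    · exact ⟨C.pt i, fun h' => absurd h' h⟩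
  choose y hy using this
  refine ⟨fun q => ∀ i, (C.set i).Nontrivial → ¬ (C.pt i ∈ q ∧ y i ∈ q),
    fun q q' h hq i hi hmem => hq i hi ⟨h hmem.1, h hmem.2⟩, fun x => ?_,
    fun i hi => ⟨y i, (hy i hi).1, fun q hq => hq i hi⟩⟩
  -- Only `x` itself can survive among the marked points, so no pair is contained.
  refine ⟨((range C.pt ∪ range y) \ {x})ᶜ,
    (((finite_range _).union (finite_range _)).subset sdiff_subset).isClosed.isOpen_compl,
    fun h => h.2 rfl, fun i hi hmem => (hy i hi).2 ?_⟩
  have h₁ : C.pt i = x := by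
    by_contra h
    exact hmem.1 ⟨Or.inl (mem_range_self i), h⟩
  have h₂ : y i = x := by
    by_contra h
    exact hmem.2 ⟨Or.inr (mem_range_self i), h⟩
  rw [h₁, h₂]

end PointedCover

/-! ### Cofinal sequences of covers -/

/-- In a second-countable compact space there are countably many open covers which are cofinal for
refinement. -/
theorem exists_seq_cofinal_openCover (X : Type*) [TopologicalSpace X]
    [SecondCountableTopology X] [CompactSpace X] :
    ∃ F : ℕ → Set (Set X), (∀ n, ∀ b ∈ F n, IsOpen b) ∧ (∀ n x, ∃ b ∈ F n, x ∈ b) ∧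
      ∀ 𝒰 : Set (Set X), (∀ u ∈ 𝒰, IsOpen u) → (∀ x, ∃ u ∈ 𝒰, x ∈ u) →
        ∃ n, ∀ b ∈ F n, ∃ u ∈ 𝒰, b ⊆ u := by
  let B := TopologicalSpace.countableBasis X
  have hB : TopologicalSpace.IsTopologicalBasis B := TopologicalSpace.isBasis_countableBasis X
  -- Finite covers by basic sets: countably many, and cofinal by compactness.
  let S : Set (Set (Set X)) := {t | (t.Finite ∧ t ⊆ B) ∧ ∀ x, ∃ b ∈ t, x ∈ b}
  have hS : S.Countable :=
    (countable_ofPred_finite_subset (TopologicalSpace.countable_countableBasis X)).mono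
      fun t ht => ht.1
  have hex : ∀ 𝒰 : Set (Set X), (∀ u ∈ 𝒰, IsOpen u) → (∀ x, ∃ u ∈ 𝒰, x ∈ u) →
      ∃ t ∈ S, ∀ b ∈ t, ∃ u ∈ 𝒰, b ⊆ u := by
    intro 𝒰 ho hc
    choose u hu hxu using hc
    choose b hbB hxb hbu using fun x => hB.exists_subset_of_mem_open (hxu x) (ho _ (hu x))
    obtain ⟨t, ht⟩ := CompactSpace.elim_nhds_subcover b
      fun x => (hB.isOpen (hbB x)).mem_nhds (hxb x)
    refine ⟨b '' t, ⟨⟨t.finite_toSet.image b, ?_⟩, fun x => ?_⟩, ?_⟩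
    · rintro _ ⟨x, -, rfl⟩
      exact hbB x
    · have hx : x ∈ ⋃ y ∈ t, b y := by rw [ht]; trivial
      obtain ⟨y, hy, hxy⟩ := mem_iUnion₂.1 hx
      exact ⟨b y, ⟨y, hy, rfl⟩, hxy⟩
    · rintro _ ⟨x, -, rfl⟩
      exact ⟨u x, hu x, hbu x⟩
  obtain ⟨t₀, ht₀, -⟩ := hex {univ} (by simp) (by simp)
  obtain ⟨F, hF⟩ := hS.exists_eq_range ⟨t₀, ht₀⟩
  have hFS : ∀ n, F n ∈ S := fun n => hF ▸ mem_range_self n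
  refine ⟨F, fun n b hb => hB.isOpen ((hFS n).1.2 hb), fun n => (hFS n).2, fun 𝒰 ho hc => ?_⟩
  obtain ⟨t, ht, hb⟩ := hex 𝒰 ho hc
  rw [hF] at ht
  obtain ⟨n, rfl⟩ := ht
  exact ⟨n, hb⟩

/-- A sequence of pointed covers, each a consolidating refinement of its predecessor, which is
eventually finer than any open cover. -/
structure ConsolidatingSequence (X : Type*) [TopologicalSpace X] where
  /-- The covers. -/
  cover : ℕ → PointedCover X
  subset_succ : ∀ n j i, (cover (n + 1)).pt j ∈ (cover n).set i →
    (cover (n + 1)).set j ⊆ (cover n).set i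
  exists_succ : ∀ n x, ∃ j, x ∈ (cover (n + 1)).set j ∧
    ∀ i, x ∈ (cover n).set i → (cover (n + 1)).set j ⊆ (cover n).set i
  refines : ∀ 𝒰 : Set (Set X), (∀ u ∈ 𝒰, IsOpen u) → (∀ x, ∃ u ∈ 𝒰, x ∈ u) →
    ∃ n, ∀ j, ∃ u ∈ 𝒰, (cover n).set j ⊆ u
  separates_succ : ∀ n i, ((cover n).set i).Nontrivial →
    {j | (cover (n + 1)).set j ⊆ (cover n).set i}.Nontrivial
  star_succ : T2Space X → ∀ n j, ∃ i, ∀ j',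
    ((cover (n + 1)).set j ∩ (cover (n + 1)).set j').Nonempty →
      (cover (n + 1)).set j' ⊆ (cover n).set i

theorem ConsolidatingSequence.nonempty (X : Type*) [TopologicalSpace X] [Nonempty X]
    [SecondCountableTopology X] [CompactSpace X] [T1Space X] :
    Nonempty (ConsolidatingSequence X) := by
  obtain ⟨F, hFo, hFc, hF⟩ := exists_seq_cofinal_openCover X
  have hstep : ∀ (n : ℕ) (C : PointedCover X), ∃ D : PointedCover X,
      (∀ j, ∃ u ∈ F n, D.set j ⊆ u) ∧
      (∀ x, ∃ j, x ∈ D.set j ∧ ∀ i, x ∈ C.set i → D.set j ⊆ C.set i) ∧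
      (∀ j i, D.pt j ∈ C.set i → D.set j ⊆ C.set i) ∧
      (∀ i, (C.set i).Nontrivial → {j | D.set j ⊆ C.set i}.Nontrivial) ∧
      (T2Space X → ∀ j, ∃ i, ∀ j', (D.set j ∩ D.set j').Nonempty → D.set j' ⊆ C.set i) := by
    intro n C
    obtain ⟨P, hPm, hPx, hP⟩ := C.exists_separating_small
    obtain ⟨Q, hQm, hQx, hQ⟩ : ∃ Q : Set X → Prop, (∀ q q', q ⊆ q' → Q q' → Q q) ∧
        (∀ x, ∃ q, IsOpen q ∧ x ∈ q ∧ Q q) ∧ (T2Space X →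
        ∀ q, Q q → ∃ i, ∀ q', Q q' → (q ∩ q').Nonempty → q' ⊆ C.set i) := by
      by_cases hX : T2Space X
      · obtain ⟨Q, h₁, h₂, h₃⟩ := C.exists_star_small
        exact ⟨Q, h₁, h₂, fun _ => h₃⟩
      · exact ⟨fun _ => True, fun _ _ _ h => h, fun x => ⟨univ, isOpen_univ, trivial, trivial⟩,
          fun h => absurd h hX⟩
    obtain ⟨D, hDP, hDx, hDpt⟩ := C.exists_consolidation
      (P := fun q => (∃ u ∈ F n, q ⊆ u) ∧ P q ∧ Q q)
      (fun q q' h ⟨⟨u, hu, hqu⟩, hp, hq⟩ =>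
        ⟨⟨u, hu, h.trans hqu⟩, hPm _ _ h hp, hQm _ _ h hq⟩)
      (fun x => by
        obtain ⟨u, hu, hxu⟩ := hFc n x
        obtain ⟨p, hpo, hxp, hp⟩ := hPx x
        obtain ⟨q, hqo, hxq, hq⟩ := hQx x
        exact ⟨u ∩ (p ∩ q), (hFo n u hu).inter (hpo.inter hqo), ⟨hxu, hxp, hxq⟩,
          ⟨u, hu, inter_subset_left⟩, hPm _ _ (fun z hz => hz.2.1) hp,
          hQm _ _ (fun z hz => hz.2.2) hq⟩)
    refine ⟨D, fun j => (hDP j).1, hDx, hDpt, fun i hi => ?_, fun hX j => ?_⟩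
    · obtain ⟨y, hy, hsep⟩ := hP i hi
      obtain ⟨j, hj, hjC⟩ := hDx (C.pt i)
      obtain ⟨k, hk, hkC⟩ := hDx y
      refine ⟨j, hjC i ((C.pt_mem_iff i i).2 rfl), k, hkC i hy, ?_⟩
      rintro rfl
      exact hsep _ (hDP j).2.1 ⟨hj, hk⟩
    · obtain ⟨i, hi⟩ := hQ hX _ (hDP j).2.2
      exact ⟨i, fun j' h => hi _ (hDP j').2.2 h⟩
  choose next h₁ h₂ h₃ h₄ h₅ using hstep
  let C₀ : PointedCover X := ⟨1, fun _ => univ, fun _ => Classical.arbitrary X,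
    fun _ => isOpen_univ, fun _ => ⟨0, trivial⟩,
    fun i j => ⟨fun _ => Subsingleton.elim _ _, fun _ => trivial⟩⟩
  let C : ℕ → PointedCover X := fun n => Nat.rec C₀ next n
  refine ⟨⟨C, fun n => h₃ n (C n), fun n => h₂ n (C n), fun 𝒰 ho hc => ?_,
    fun n => h₄ n (C n), fun hX n => h₅ n (C n) hX⟩⟩
  obtain ⟨n, hn⟩ := hF 𝒰 ho hc
  refine ⟨n + 1, fun j => ?_⟩
  obtain ⟨b, hb, hjb⟩ := h₁ n (C n) j
  obtain ⟨u, hu, hbu⟩ := hn b hb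
  exact ⟨u, hu, hjb.trans hbu⟩

/-! ### The sequence of nerves -/

namespace ConsolidatingSequence

variable {X : Type*} [TopologicalSpace X] (c : ConsolidatingSequence X)

/-- The `n`-th cover is indexed by `Fin` of this number. -/
abbrev Idx (n : ℕ) : Type := Fin (c.cover n).size

/-- The `i`-th member of the `n`-th cover. -/
abbrev set (n : ℕ) (i : c.Idx n) : Set X := (c.cover n).set i

/-- The distinguished point of the `i`-th member of the `n`-th cover. -/
abbrev pt (n : ℕ) (i : c.Idx n) : X := (c.cover n).pt i

theorem pt_mem (n : ℕ) (i : c.Idx n) : c.pt n i ∈ c.set n i :=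
  ((c.cover n).pt_mem_iff i i).2 rfl

theorem exists_subset_of_mem {m n : ℕ} (hmn : m ≤ n) {x : X} {i : c.Idx m}
    (hx : x ∈ c.set m i) : ∃ j, x ∈ c.set n j ∧ c.set n j ⊆ c.set m i := by
  induction n, hmn using Nat.le_induction with
  | base => exact ⟨i, hx, subset_rfl⟩
  | succ n _ ih =>
    obtain ⟨j, hj, hji⟩ := ih
    obtain ⟨k, hk, hkn⟩ := c.exists_succ n x
    exact ⟨k, hk, (hkn j hj).trans hji⟩

/-- One member works for all `i` at once, which is what edge-witnessing needs; this requires a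
strictly later level. -/
theorem exists_subset_of_lt {m n : ℕ} (hmn : m < n) (x : X) :
    ∃ j, x ∈ c.set n j ∧ ∀ i, x ∈ c.set m i → c.set n j ⊆ c.set m i := by
  obtain ⟨k, hk, hkm⟩ := c.exists_succ m x
  obtain ⟨j, hj, hjk⟩ := c.exists_subset_of_mem (Nat.succ_le_of_lt hmn) hk
  exact ⟨j, hj, fun i hi => hjk.trans (hkm i hi)⟩

/-- Inclusion is detected by one point: the level just before `n` has a member around that point
inside `c.set m i`, and `subset_succ` applies to it. -/
theorem pt_mem_iff_subset {m n : ℕ} (hmn : m ≤ n) {i : c.Idx m} {j : c.Idx n} :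
    c.pt n j ∈ c.set m i ↔ c.set n j ⊆ c.set m i := by
  refine ⟨fun h => ?_, fun h => h (c.pt_mem n j)⟩
  obtain rfl | hlt := hmn.eq_or_lt
  · rw [((c.cover m).pt_mem_iff j i).1 h]
  · obtain ⟨n, rfl⟩ : ∃ k, n = k + 1 := ⟨n - 1, by omega⟩
    obtain ⟨k, hk, hki⟩ := c.exists_subset_of_mem (Nat.le_of_lt_succ hlt) h
    exact (c.subset_succ n j k hk).trans hki

theorem exists_superset {m n : ℕ} (hmn : m ≤ n) (j : c.Idx n) :
    ∃ i, c.set n j ⊆ c.set m i := by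
  obtain ⟨i, hi⟩ := (c.cover m).exists_mem (c.pt n j)
  exact ⟨i, (c.pt_mem_iff_subset hmn).1 hi⟩

theorem eq_of_subset {n : ℕ} {i j : c.Idx n} (h : c.set n j ⊆ c.set n i) : j = i :=
  ((c.cover n).pt_mem_iff j i).1 (h (c.pt_mem n j))

/-- Every open cover is refined by all sufficiently late covers of the sequence. -/
theorem exists_refines_ge {𝒰 : Set (Set X)} (ho : ∀ u ∈ 𝒰, IsOpen u)
    (hc : ∀ x, ∃ u ∈ 𝒰, x ∈ u) : ∃ m, ∀ n, m ≤ n → ∀ j, ∃ u ∈ 𝒰, c.set n j ⊆ u := by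
  obtain ⟨m, hm⟩ := c.refines 𝒰 ho hc
  refine ⟨m, fun n hmn j => ?_⟩
  obtain ⟨i, hi⟩ := c.exists_superset hmn j
  obtain ⟨u, hu, hiu⟩ := hm i
  exact ⟨u, hu, hi.trans hiu⟩

theorem exists_forall_subset_of_isOpen [T1Space X] {U : Set X} (hU : IsOpen U) {x : X}
    (hx : x ∈ U) : ∃ m, ∀ n, m ≤ n → ∀ j, x ∈ c.set n j → c.set n j ⊆ U := by
  -- A set containing `x` cannot lie in `{x}ᶜ`, so it must lie in `U`.
  obtain ⟨m, hm⟩ := c.exists_refines_ge (𝒰 := {U, {x}ᶜ})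
    (by rintro u (rfl | rfl); exacts [hU, isOpen_compl_singleton])
    (fun y => by
      by_cases h : y = x
      · exact ⟨U, Or.inl rfl, h ▸ hx⟩
      · exact ⟨{x}ᶜ, Or.inr rfl, h⟩)
  refine ⟨m, fun n hn j hj => ?_⟩
  obtain ⟨u, rfl | rfl, hu⟩ := hm n hn j
  · exact hu
  · exact absurd rfl (hu hj)

variable [Nonempty X]

/-- The nerve of the `n`-th cover. -/
def graph (n : ℕ) : FinGraph where
  V := c.Idx n
  finite := inferInstance
  nonempty := ⟨((c.cover n).exists_mem (Classical.arbitrary X)).choose⟩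
  Edge i j := (c.set n i ∩ c.set n j).Nonempty
  edge_refl i := ⟨c.pt n i, c.pt_mem n i, c.pt_mem n i⟩
  edge_symm i j h := by rwa [inter_comm]

/-- The sequence of nerves, related by inclusion. -/
def graphSequence : GraphSequence where
  G := c.graph
  rel m n _ i j := c.set n j ⊆ c.set m i
  edgePreserving := by
    rintro m n hmn h h' g g' hg ⟨x, hx, hx'⟩ hg'
    exact ⟨x, hg hx, hg' hx'⟩
  rel_self n p q := by
    refine ⟨fun h => (c.eq_of_subset h).symm, ?_⟩
    rintro rfl
    exact subset_rfl
  rel_comp l m n hlm hmn p q := by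
    refine ⟨fun h => ?_, fun ⟨t, h₁, h₂⟩ => h₂.trans h₁⟩
    obtain ⟨t, ht, htp⟩ := c.exists_subset_of_mem hlm (h (c.pt_mem n q))
    exact ⟨t, htp, (c.pt_mem_iff_subset hmn).1 ht⟩

theorem isCoBijective : c.graphSequence.IsCoBijective := by
  refine fun m n hmn => ⟨fun j => c.exists_superset hmn j, fun i => ?_⟩
  obtain ⟨j, hj, hji⟩ := c.exists_subset_of_mem hmn (c.pt_mem m i)
  refine ⟨j, fun i' => ⟨fun h => ?_, ?_⟩⟩
  · exact (((c.cover m).pt_mem_iff i i').1 (h hj)).symm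
  · rintro rfl
    exact hji

theorem isEdgeWitnessing : c.graphSequence.IsEdgeWitnessing := by
  rintro m n hmn i i' ⟨x, hx, hx'⟩
  obtain ⟨j, -, hj⟩ := c.exists_subset_of_lt hmn x
  exact ⟨j, hj i hx, hj i' hx'⟩

theorem isAntiInjective [PerfectSpace X] : c.graphSequence.IsAntiInjective := by
  intro m n hmn i
  obtain ⟨y, hy, hyne⟩ := accPt_iff_nhds.1
    (((c.cover m).isOpen i).preperfect _ (c.pt_mem m i)) univ Filter.univ_mem
  obtain ⟨k, hk, k', hk', hne⟩ := c.separates_succ m i ⟨y, hy.2, _, c.pt_mem m i, hyne⟩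
  obtain ⟨j, hj, hjk⟩ := c.exists_subset_of_mem (Nat.succ_le_of_lt hmn) (c.pt_mem _ k)
  obtain ⟨j', -, hjk'⟩ := c.exists_subset_of_mem (Nat.succ_le_of_lt hmn) (c.pt_mem _ k')
  refine ⟨j, hjk.trans hk, j', hjk'.trans hk', ?_⟩
  -- A common member would place the private point of `k` in `k'`.
  rintro rfl
  exact hne (((c.cover _).pt_mem_iff k k').1 (hjk' hj))

theorem isStarRefining [T2Space X] : c.graphSequence.IsStarRefining := by
  intro m n hmn j
  obtain ⟨k, hk⟩ := c.exists_superset (Nat.succ_le_of_lt hmn) j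
  obtain ⟨i, hi⟩ := c.star_succ inferInstance m k
  refine ⟨i, ?_⟩
  rintro j' ⟨x, hx, hx'⟩
  obtain ⟨k', hk'⟩ := c.exists_superset (Nat.succ_le_of_lt hmn) j'
  exact hk'.trans (hi k' ⟨x, hk hx, hk' hx'⟩)

/-! ### The spectrum of the induced poset -/

/-- The open set named by an element of the induced poset. -/
def nameSet (p : c.graphSequence.InducedPoset) : Set X := c.set p.1 p.2

theorem isOpen_nameSet (p : c.graphSequence.InducedPoset) : IsOpen (c.nameSet p) :=
  (c.cover p.1).isOpen p.2

theorem nameSet_mono {p q : c.graphSequence.InducedPoset} (h : p ≤ q) :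
    c.nameSet p ⊆ c.nameSet q := h.2

/-- The `n`-th level of the induced poset. -/
def level (n : ℕ) : Set c.graphSequence.InducedPoset :=
  range fun i : c.Idx n => (⟨n, i⟩ : c.graphSequence.InducedPoset)

theorem isBand_level (n : ℕ) : IsBand (c.level n) := by
  refine ⟨finite_range _, ?_⟩
  rintro ⟨m, i⟩
  obtain h | h := le_total m n
  · obtain ⟨j, -, hj⟩ := c.exists_subset_of_mem h (c.pt_mem m i)
    exact ⟨⟨n, j⟩, ⟨j, rfl⟩, Or.inl ⟨h, hj⟩⟩
  · obtain ⟨j, hj⟩ := c.exists_superset h i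
    exact ⟨⟨n, j⟩, ⟨j, rfl⟩, Or.inr ⟨h, hj⟩⟩

/-- No band element lies deeper than level `N`, so one below a level-`N` member around `x` equals
it, and one above it contains `x`. -/
theorem exists_mem_nameSet_of_isCap {C : Set c.graphSequence.InducedPoset} (hC : IsCap C)
    (x : X) : ∃ p ∈ C, x ∈ c.nameSet p := by
  obtain ⟨B, ⟨hBfin, hB⟩, hBC⟩ := hC
  obtain ⟨N, hN⟩ := (hBfin.image Sigma.fst).bddAbove
  obtain ⟨j, hj⟩ := (c.cover N).exists_mem x
  have hxB : ∃ b ∈ B, x ∈ c.nameSet b := by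
    obtain ⟨b, hb, h | h⟩ := hB ⟨N, j⟩
    · obtain ⟨hle, hsub⟩ := h
      have hbN : b.1 = N := le_antisymm (hN ⟨b, hb, rfl⟩) hle
      obtain ⟨n, i⟩ := b
      obtain rfl : n = N := hbN
      obtain rfl := c.eq_of_subset hsub
      exact ⟨_, hb, hj⟩
    · exact ⟨b, hb, c.nameSet_mono h hj⟩
  obtain ⟨b, hb, hxb⟩ := hxB
  obtain ⟨p, hp, hbp⟩ := hBC b hb
  exact ⟨p, hp, c.nameSet_mono hbp hxb⟩

/-- The elements of the induced poset whose sets contain `x`. -/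
def names (x : X) : Set c.graphSequence.InducedPoset := {p | x ∈ c.nameSet p}

theorem isSelector_names (x : X) : IsSelector (c.names x) := by
  intro C hC
  obtain ⟨p, hp, hx⟩ := c.exists_mem_nameSet_of_isCap hC x
  exact ⟨p, hx, hp⟩

theorem exists_names_subset [CompactSpace X] {S : Set c.graphSequence.InducedPoset}
    (hS : IsSelector S) : ∃ x, c.names x ⊆ S := by
  by_contra! hcon
  choose p hp hpS using fun x => not_subset.1 (hcon x)
  obtain ⟨t, ht⟩ := CompactSpace.elim_nhds_subcover (fun x => c.nameSet (p x))
    fun x => (c.isOpen_nameSet _).mem_nhds (hp x)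
  obtain ⟨m, hm⟩ := c.exists_refines_ge (𝒰 := (fun x => c.nameSet (p x)) '' t)
    (by rintro _ ⟨x, -, rfl⟩; exact c.isOpen_nameSet _)
    (fun x => by
      have hx : x ∈ ⋃ y ∈ t, c.nameSet (p y) := by rw [ht]; trivial
      obtain ⟨y, hy, hxy⟩ := mem_iUnion₂.1 hx
      exact ⟨_, ⟨y, hy, rfl⟩, hxy⟩)
  obtain ⟨N, hN⟩ := (t.finite_toSet.image fun x => (p x).1).bddAbove
  -- The order also compares levels, so the band must be at least as deep as every `p x` as well as
  -- fine enough. The resulting cap misses `S`.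
  obtain ⟨q, hqS, x, hx, rfl⟩ := hS (p '' t) ⟨c.level (max m N), c.isBand_level _, by
    rintro _ ⟨j, rfl⟩
    obtain ⟨_, ⟨x, hx, rfl⟩, hj⟩ := hm _ (le_max_left m N) j
    exact ⟨p x, ⟨x, hx, rfl⟩, (hN ⟨x, hx, rfl⟩).trans (le_max_right m N), hj⟩⟩
  exact hpS x hqS

theorem minimal_names [T1Space X] (x : X) : Minimal IsSelector (c.names x) := by
  refine ⟨c.isSelector_names x, fun S hS hSx p hp => ?_⟩
  obtain ⟨m, hm⟩ := c.exists_forall_subset_of_isOpen (c.isOpen_nameSet p) hp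
  -- Far enough down, members around `x` lie below `p`, so this is a cap; `p` is its only element
  -- that names `x`.
  obtain ⟨q, hqS, hq⟩ := hS (insert p {q | x ∉ c.nameSet q})
    ⟨c.level (max m p.1), c.isBand_level _, by
      rintro _ ⟨j, rfl⟩
      by_cases hx : x ∈ c.set (max m p.1) j
      · exact ⟨p, mem_insert _ _, le_max_right m p.1, hm _ (le_max_left m p.1) j hx⟩
      · exact ⟨_, mem_insert_of_mem _ hx, le_rfl⟩⟩
  obtain rfl | hq := hq
  · exact hqS
  · exact absurd (hSx hqS) hq

/-- The point of the spectrum given by a point of the space. -/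
def toSpectrum [T1Space X] (x : X) : PosetSpectrum c.graphSequence.InducedPoset :=
  ⟨c.names x, c.minimal_names x⟩

theorem exists_nameSet_subset [T1Space X] {U : Set X} (hU : IsOpen U) {x : X} (hx : x ∈ U) :
    ∃ p, x ∈ c.nameSet p ∧ c.nameSet p ⊆ U := by
  obtain ⟨m, hm⟩ := c.exists_forall_subset_of_isOpen hU hx
  obtain ⟨j, hj⟩ := (c.cover m).exists_mem x
  exact ⟨⟨m, j⟩, hj, hm m le_rfl j hj⟩

theorem toSpectrum_injective [T1Space X] : Function.Injective c.toSpectrum := by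
  intro x y h
  by_contra hne
  obtain ⟨p, hxp, hp⟩ := c.exists_nameSet_subset (U := {y}ᶜ) isOpen_compl_singleton hne
  have hy : p ∈ c.names y := by
    rw [← show c.names x = c.names y from congrArg Subtype.val h]
    exact hxp
  exact hp hy rfl

theorem toSpectrum_surjective [T1Space X] [CompactSpace X] :
    Function.Surjective c.toSpectrum := by
  rintro ⟨S, hS⟩
  obtain ⟨x, hx⟩ := c.exists_names_subset hS.prop
  exact ⟨x, Subtype.ext (hx.antisymm (hS.le_of_le (c.isSelector_names x) hx))⟩

theorem continuous_toSpectrum [T1Space X] : Continuous c.toSpectrum := by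
  refine continuous_generateFrom_iff.2 ?_
  rintro _ ⟨p, rfl⟩
  exact c.isOpen_nameSet p

theorem isOpenMap_toSpectrum [T1Space X] [CompactSpace X] : IsOpenMap c.toSpectrum := by
  intro U hU
  rw [isOpen_iff_forall_mem_open]
  rintro _ ⟨x, hx, rfl⟩
  obtain ⟨p, hxp, hpU⟩ := c.exists_nameSet_subset hU hx
  refine ⟨{S | p ∈ S.1}, fun S hS => ?_,
    TopologicalSpace.isOpen_generateFrom_of_mem ⟨p, rfl⟩, hxp⟩
  obtain ⟨y, rfl⟩ := c.toSpectrum_surjective S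
  exact ⟨y, hpU hS, rfl⟩

/-- The space is homeomorphic to the spectrum of the sequence of nerves. -/
noncomputable def homeomorphSpectrum [T1Space X] [CompactSpace X] :
    X ≃ₜ PosetSpectrum c.graphSequence.InducedPoset :=
  (Equiv.ofBijective c.toSpectrum
    ⟨c.toSpectrum_injective, c.toSpectrum_surjective⟩).toHomeomorphOfContinuousOpen
      c.continuous_toSpectrum c.isOpenMap_toSpectrum

end ConsolidatingSequence

theorem mainTheorem10 (X : Type*) [TopologicalSpace X] [Nonempty X]
    [SecondCountableTopology X] [CompactSpace X] [T1Space X] :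
    ∃ s : GraphSequence,
      s.IsCoBijective ∧
      s.IsEdgeWitnessing ∧
      (PerfectSpace X → s.IsAntiInjective) ∧
      (T2Space X → s.IsStarRefining) ∧
      Nonempty (PosetSpectrum s.InducedPoset ≃ₜ X) := by
  obtain ⟨c⟩ := ConsolidatingSequence.nonempty X
  exact ⟨c.graphSequence, c.isCoBijective, c.isEdgeWitnessing, fun _ => c.isAntiInjective,
    fun _ => c.isStarRefining, ⟨c.homeomorphSpectrum.symm⟩⟩
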